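/- For a field $F$ and an integer $n\ge 1$ let $J_n$ be the $n\times n$ matrix over $F$ with entries $1$ in the positions $(i,i)$, $1\le i\le n$, and $(i,i+1)$, $1\le i<n$, and $0$ elsewhere. For integers $1\le r\le s$ and a field $F$ of prime characteristic $p$, the Kronecker product $J_r\otimes J_s$ is similar over $F$ to $J_{\lambda_1}\oplus\cdots\oplus J_{\lambda_r}$ for a unique sequence of integers $\lambda_1\ge\cdots\ge\lambda_r>0$. Write $\lambda(r,s,p)=(\lambda_1,\dots,\lambda_r)$ (it depends only on $r$, $s$ and $p$) and define the deviation vector $\varepsilon(r,s,p)=(\lambda_1-s,\dots,\lambda_r-s)\in\mathbb{Z}^r$. Theorem. For every fixed integer $r\ge 1$, there are at most $2^{r-1}$ distinct deviation vectors $\varepsilon(r,s,p)$ as $s$ varies over all integers $s\ge r$ and $p$ over all primes (with $F$ any field of characteristic $p$). -/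

import Mathlib

open scoped Kronecker

universe u

namespace JordanTensor

/-- The `n × n` unipotent upper triangular Jordan block: ones on the diagonal and directly above
it, zeros elsewhere. -/
def jordanBlock (F : Type*) [Field F] (n : ℕ) : Matrix (Fin n) (Fin n) F :=
  Matrix.of fun i j => if j = i ∨ (j : ℕ) = i + 1 then 1 else 0

/-- `lam = (lam 0 ≥ ⋯ ≥ lam (r - 1) > 0)` is the Jordan partition of `J_r ⊗ J_s` over `F`: the
Kronecker product is similar over `F` to the block diagonal matrix with diagonal blocks
`J_{lam 0}, …, J_{lam (r - 1)}`. The similarity is given by mutually inverse matrices `P`, `Q`, whose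
rows and columns are indexed by the two (equinumerous) index sets of the matrices concerned. -/
structure IsJordanPartition (F : Type*) [Field F] (r s : ℕ) (lam : Fin r → ℕ) : Prop where
  antitone : Antitone lam
  pos : ∀ i, 0 < lam i
  similar : ∃ (P : Matrix (Fin r × Fin s) (Σ i, Fin (lam i)) F)
      (Q : Matrix (Σ i, Fin (lam i)) (Fin r × Fin s) F),
    P * Q = 1 ∧ Q * P = 1 ∧
    Q * (jordanBlock F r ⊗ₖ jordanBlock F s) * P =
        Matrix.blockDiagonal' fun i => jordanBlock F (lam i)

theorem jordanBlock_sub_one_pow (F : Type*) [Field F] (n k : ℕ) :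
    (jordanBlock F n - 1) ^ k = Matrix.of fun i j : Fin n => if (j : ℕ) = i + k then 1 else 0 := by
  have h1 : jordanBlock F n - 1 =
      Matrix.of fun i j : Fin n => if (j : ℕ) = i + 1 then (1 : F) else 0 := by
    ext i j
    simp only [jordanBlock, Matrix.sub_apply, Matrix.of_apply, Matrix.one_apply, Fin.ext_iff]
    split_ifs <;> first | omega | simp
  induction k with
  | zero =>
    ext i j
    simp [Matrix.one_apply, Fin.ext_iff, eq_comm]
  | succ k ih =>
    rw [pow_succ, ih, h1]
    ext i j
    simp only [Matrix.mul_apply, Matrix.of_apply, ite_mul, one_mul, zero_mul]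
    by_cases h : (j : ℕ) = i + (k + 1)
    · rw [Finset.sum_eq_single (⟨i + k, by omega⟩ : Fin n)]
      · simp [h]; omega
      · intro b _ hb
        have : (b : ℕ) ≠ i + k := fun h => hb (Fin.ext h)
        simp [this]
      · simp
    · rw [if_neg h]
      apply Finset.sum_eq_zero
      intro b _
      split_ifs <;> first | omega | rfl

theorem card_sigma_shift {d : ℕ} (lam : Fin d → ℕ) (k : ℕ) :
    Fintype.card (Σ i, Fin (lam i - k)) = ∑ i, (lam i - k) := by simp

theorem rank_blockDiagonal_sub_one_pow (F : Type*) [Field F] {d : ℕ} (lam : Fin d → ℕ) (k : ℕ) :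
    (((Matrix.blockDiagonal' fun i => jordanBlock F (lam i)) - 1) ^ k).rank
      = ∑ i, (lam i - k) := by
  rw [← Matrix.blockDiagonal'_one, ← Matrix.blockDiagonal'_sub, ← Matrix.blockDiagonal'_pow]
  set S := Matrix.blockDiagonal' (((fun i => jordanBlock F (lam i)) - 1) ^ k) with hS
  have hS' : S = Matrix.of fun x y : Σ i, Fin (lam i) =>
      if x.1 = y.1 ∧ (y.2 : ℕ) = x.2 + k then (1 : F) else 0 := by
    ext ⟨i, a⟩ ⟨j, b⟩
    by_cases h : i = j
    · subst h
      rw [hS, Matrix.blockDiagonal'_apply_eq]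
      simp [Pi.pow_apply, jordanBlock_sub_one_pow]
    · rw [hS, Matrix.blockDiagonal'_apply_ne _ _ _ h]
      simp [h]
  let f : (Σ i, Fin (lam i - k)) → Σ i, Fin (lam i) := fun x => ⟨x.1, ⟨x.2, by omega⟩⟩
  let g : (Σ i, Fin (lam i - k)) → Σ i, Fin (lam i) := fun x => ⟨x.1, ⟨x.2 + k, by omega⟩⟩
  let A : Matrix (Σ i, Fin (lam i)) (Σ i, Fin (lam i - k)) F :=
    (1 : Matrix _ _ F).submatrix id f
  let B : Matrix (Σ i, Fin (lam i - k)) (Σ i, Fin (lam i)) F :=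
    (1 : Matrix _ _ F).submatrix g id
  have hf : Function.Injective f := by
    rintro ⟨i, a⟩ ⟨j, b⟩ h
    simp only [f, Sigma.mk.injEq] at h
    obtain ⟨rfl, h⟩ := h
    simpa [Fin.ext_iff] using h
  have hAB : S = A * B := by
    rw [hS']
    ext ⟨i, a⟩ ⟨j, b⟩
    simp only [Matrix.mul_apply, A, B, Matrix.submatrix_apply, id, Matrix.one_apply,
      Matrix.of_apply, mul_ite, mul_one, mul_zero]
    by_cases h : i = j ∧ (b : ℕ) = a + k
    · obtain ⟨rfl, h⟩ := h
      rw [Finset.sum_eq_single (⟨i, ⟨a, by omega⟩⟩ : Σ i, Fin (lam i - k))]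
      · simp [f, g, Fin.ext_iff, h]
      · intro x _ hx
        split_ifs with h1 h2
        · exact absurd (hf (h2.symm.trans rfl)) hx
        · rfl
        · rfl
      · simp
    · rw [if_neg h]
      symm
      apply Finset.sum_eq_zero
      rintro ⟨l, c⟩ _
      split_ifs with h1 h2
      · exfalso
        simp only [f, g, Sigma.mk.injEq] at h1 h2
        obtain ⟨rfl, h1⟩ := h1
        obtain ⟨rfl, h2⟩ := h2
        simp only [heq_eq_eq, Fin.ext_iff] at h1 h2
        exact h ⟨rfl, by omega⟩
      · rfl
      · rfl
  rw [← card_sigma_shift]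
  apply le_antisymm
  · rw [hAB]
    exact (Matrix.rank_mul_le_left A B).trans (Matrix.rank_le_card_width A)
  · have h1 : S.submatrix f g = 1 := by
      rw [hS']
      ext ⟨i, a⟩ ⟨j, b⟩
      simp only [Matrix.submatrix_apply, Matrix.of_apply, Matrix.one_apply, f, g]
      by_cases h : i = j
      · subst h
        simp [Fin.ext_iff, eq_comm]
      · simp [h]
    rw [← Matrix.rank_one (R := F) (n := Σ i, Fin (lam i - k)), ← h1]
    exact Matrix.rank_submatrix_le S f g

theorem rank_of_similar {F : Type*} [Field F] {m n : Type*} [Fintype m] [Fintype n]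
    [DecidableEq m] [DecidableEq n] {M : Matrix m m F} {D : Matrix n n F}
    {P : Matrix m n F} {Q : Matrix n m F}
    (h1 : P * Q = 1) (h2 : Q * P = 1) (h3 : Q * M * P = D) (k : ℕ) :
    ((M - 1) ^ k).rank = ((D - 1) ^ k).rank := by
  have key : ∀ k, (D - 1) ^ k = Q * (M - 1) ^ k * P := by
    intro k
    induction k with
    | zero => simp [h2]
    | succ k ih =>
      have : D - 1 = Q * (M - 1) * P := by
        rw [Matrix.mul_sub, Matrix.sub_mul, h3, Matrix.mul_one, h2]
      rw [pow_succ, ih, pow_succ, this]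
      calc Q * (M - 1) ^ k * P * (Q * (M - 1) * P)
          = Q * (M - 1) ^ k * (P * Q) * (M - 1) * P := by simp only [Matrix.mul_assoc]
        _ = _ := by rw [h1]; simp only [Matrix.mul_assoc, Matrix.one_mul]
  have key' : (M - 1) ^ k = P * (D - 1) ^ k * Q := by
    rw [key]
    calc (M - 1) ^ k = (P * Q) * (M - 1) ^ k * (P * Q) := by simp [h1]
      _ = _ := by simp only [Matrix.mul_assoc]
  apply le_antisymm
  · rw [key']
    exact (Matrix.rank_mul_le_left _ _).trans (Matrix.rank_mul_le_right _ _)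
  · rw [key]
    exact (Matrix.rank_mul_le_left _ _).trans (Matrix.rank_mul_le_right _ _)

theorem card_lt_add_sum {d : ℕ} (lam : Fin d → ℕ) (k : ℕ) :
    (Finset.univ.filter fun i => k < lam i).card + ∑ i, (lam i - (k + 1)) = ∑ i, (lam i - k) := by
  rw [Finset.card_filter, ← Finset.sum_add_distrib]
  apply Finset.sum_congr rfl
  intro i _
  split_ifs <;> omega

theorem IsJordanPartition.unique {F : Type*} [Field F] {r s : ℕ} {lam mu : Fin r → ℕ}
    (h : IsJordanPartition F r s lam) (h' : IsJordanPartition F r s mu) : lam = mu := by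
  obtain ⟨P, Q, h1, h2, h3⟩ := h.similar
  obtain ⟨P', Q', h1', h2', h3'⟩ := h'.similar
  have hk : ∀ k, ∑ i, (lam i - k) = ∑ i, (mu i - k) := fun k => by
    rw [← rank_blockDiagonal_sub_one_pow F, ← rank_blockDiagonal_sub_one_pow F,
      ← rank_of_similar h1 h2 h3, ← rank_of_similar h1' h2' h3']
  have hc : ∀ k, (Finset.univ.filter fun i => k < lam i).card =
      (Finset.univ.filter fun i => k < mu i).card := fun k => by
    have a := card_lt_add_sum lam k
    have b := card_lt_add_sum mu k
    rw [hk, hk] at a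
    omega
  funext j
  have e : ∀ k, k < lam j ↔ k < mu j := fun k => by
    rw [← Tuple.lt_card_gt_iff_apply_gt_of_antitone (j := j) h.antitone,
      ← Tuple.lt_card_gt_iff_apply_gt_of_antitone (j := j) h'.antitone, hc]
  exact le_antisymm (not_lt.1 fun hh => lt_irrefl _ ((e _).1 hh))
    (not_lt.1 fun hh => lt_irrefl _ ((e _).2 hh))

theorem jordanBlock_isUnit (F : Type*) [Field F] (n : ℕ) : IsUnit (jordanBlock F n) := by
  have h : IsNilpotent (jordanBlock F n - 1) := ⟨n, by
    rw [jordanBlock_sub_one_pow]; ext i j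
    simp only [Matrix.of_apply, Matrix.zero_apply, ite_eq_right_iff]; intro h; omega⟩
  simpa using h.isUnit_one_add

theorem kronecker_jordanBlock_mulVec (F : Type*) [Field F] (r s : ℕ) (v : Fin r × Fin s → F)
    (i : Fin r) (j : Fin s) :
    ((jordanBlock F r ⊗ₖ jordanBlock F s).mulVec v) (i, j) =
      (jordanBlock F r).mulVec
        (fun i' => v (i', j) + if h : (j : ℕ) + 1 < s then v (i', ⟨j + 1, h⟩) else 0) i := by
  simp only [Matrix.mulVec, dotProduct, Fintype.sum_prod_type, Matrix.kroneckerMap_apply]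
  refine Finset.sum_congr rfl fun i' _ => ?_
  simp only [mul_assoc]
  rw [← Finset.mul_sum]
  congr 1
  have h0 : ∀ j', jordanBlock F s j j' * v (i', j') =
      (if j' = j then v (i', j') else 0) + if (j' : ℕ) = j + 1 then v (i', j') else 0 := by
    intro j'
    simp only [jordanBlock, Matrix.of_apply, Fin.ext_iff]
    split_ifs <;> first | omega | simp
  simp only [h0, Finset.sum_add_distrib, Finset.sum_ite_eq', Finset.mem_univ, if_true]
  congr 1
  split_ifs with h
  · rw [Finset.sum_eq_single (⟨j + 1, h⟩ : Fin s)]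
    · simp
    · intro b _ hb
      rw [if_neg fun hh => hb (Fin.ext hh)]
    · simp
  · apply Finset.sum_eq_zero
    intro b _
    rw [if_neg (by omega)]

theorem finrank_ker_kronecker_jordanBlock (F : Type*) [Field F] {r s : ℕ} (hr : 0 < r)
    (h : r ≤ s) :
    Module.finrank F (LinearMap.ker
      (jordanBlock F r ⊗ₖ jordanBlock F s - 1).mulVecLin) = r := by
  have hmem : ∀ v : Fin r × Fin s → F, v ∈ LinearMap.ker
      (jordanBlock F r ⊗ₖ jordanBlock F s - 1).mulVecLin ↔
      (jordanBlock F r ⊗ₖ jordanBlock F s).mulVec v = v := by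
    intro v
    rw [LinearMap.mem_ker, Matrix.mulVecLin_apply, Matrix.sub_mulVec, Matrix.one_mulVec,
      sub_eq_zero]
  have hs : 0 < s := by omega
  obtain ⟨U, hU⟩ := jordanBlock_isUnit F r
  apply le_antisymm
  · let ev : (Fin r × Fin s → F) →ₗ[F] (Fin r → F) :=
      LinearMap.funLeft F F fun i => (i, (⟨0, hs⟩ : Fin s))
    have hinj : Function.Injective (ev.domRestrict (LinearMap.ker
      (jordanBlock F r ⊗ₖ jordanBlock F s - 1).mulVecLin)) := by
      rw [← LinearMap.ker_eq_bot, LinearMap.ker_eq_bot']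
      rintro ⟨v, hv⟩ hv0
      rw [hmem] at hv
      have hz : ∀ (j : ℕ) (hj : j < s) (i : Fin r), v (i, ⟨j, hj⟩) = 0 := by
        intro j
        induction j with
        | zero => exact fun hj i => congrFun hv0 i
        | succ j ih =>
          intro hj
          have e1 : (jordanBlock F r).mulVec (fun i' => v (i', ⟨j + 1, hj⟩)) = 0 := by
            ext i
            have := congrFun hv (i, ⟨j, by omega⟩)
            rw [kronecker_jordanBlock_mulVec] at this
            simpa [ih, hj] using this
          have e2 : (fun i' => v (i', ⟨j + 1, hj⟩)) = 0 := by
            rw [← Matrix.one_mulVec (fun i' => v (i', ⟨j + 1, hj⟩)), ← Units.inv_mul U, hU,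
              ← Matrix.mulVec_mulVec, e1, Matrix.mulVec_zero]
          exact fun i => congrFun e2 i
      ext ⟨i, j⟩
      exact hz j j.2 i
    simpa using LinearMap.finrank_le_finrank_of_injective hinj
  · let T : Matrix (Fin r) (Fin r) F := (↑U⁻¹ : Matrix (Fin r) (Fin r) F) - 1
    have hJT : jordanBlock F r * (1 + T) = 1 := by simp [T, ← hU]
    have hTr : T ^ r = 0 := by
      have e : T = (↑U⁻¹ : Matrix (Fin r) (Fin r) F) * -(jordanBlock F r - 1) := by
        simp [T, ← hU, mul_sub]
      have hc : Commute (↑U⁻¹ : Matrix (Fin r) (Fin r) F) (-(jordanBlock F r - 1)) := by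
        rw [← hU]
        apply Commute.neg_right
        apply Commute.sub_right _ (Commute.one_right _)
        exact (U.inv_mul.trans U.mul_inv.symm)
      rw [e, hc.mul_pow, neg_pow, jordanBlock_sub_one_pow]
      have : (Matrix.of fun i j : Fin r => if (j : ℕ) = i + r then (1 : F) else 0) = 0 := by
        ext i j
        simp only [Matrix.of_apply, Matrix.zero_apply, ite_eq_right_iff]; intro h; omega
      rw [this]; simp
    let f : (Fin r → F) →ₗ[F] (Fin r × Fin s → F) :=
      LinearMap.pi fun x => (LinearMap.proj x.1).comp (T ^ (x.2 : ℕ)).mulVecLin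
    have hf : ∀ c x, f c x = (T ^ (x.2 : ℕ)).mulVec c x.1 := fun c x => rfl
    have hker : ∀ c, f c ∈ LinearMap.ker
        (jordanBlock F r ⊗ₖ jordanBlock F s - 1).mulVecLin := by
      intro c
      rw [hmem]
      ext ⟨i, j⟩
      rw [kronecker_jordanBlock_mulVec, hf]
      have e : (fun i' => f c (i', j) +
          if h : (j : ℕ) + 1 < s then f c (i', ⟨j + 1, h⟩) else 0) =
          ((1 + T) * T ^ (j : ℕ)).mulVec c := by
        ext i'
        rw [add_mul, one_mul, Matrix.add_mulVec, Pi.add_apply, hf, ← pow_succ']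
        congr 1
        split_ifs with h1
        · rfl
        · have : T ^ ((j : ℕ) + 1) = 0 := pow_eq_zero_of_le (by omega) hTr
          simp [this]
      rw [e, Matrix.mulVec_mulVec, ← mul_assoc, hJT, one_mul]
    have hinj : Function.Injective (f.codRestrict _ hker) := by
      intro c c' hcc
      ext i
      have := congrFun (congrArg Subtype.val hcc) (i, (⟨0, hs⟩ : Fin s))
      simpa [hf] using this
    simpa using LinearMap.finrank_le_finrank_of_injective hinj

theorem isNilpotent_kronecker_jordanBlock_sub_one (F : Type*) [Field F] (r s : ℕ) :
    IsNilpotent (jordanBlock F r ⊗ₖ jordanBlock F s - 1) := by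
  have hn : ∀ n, (jordanBlock F n - 1) ^ n = 0 := fun n => by
    rw [jordanBlock_sub_one_pow]; ext i j
    simp only [Matrix.of_apply, Matrix.zero_apply, ite_eq_right_iff]; intro h; omega
  have hpow : ∀ (A : Matrix (Fin r) (Fin r) F) (B : Matrix (Fin s) (Fin s) F) (k : ℕ),
      (A ⊗ₖ B) ^ k = (A ^ k) ⊗ₖ (B ^ k) := by
    intro A B k
    induction k with
    | zero => simp
    | succ k ih => rw [pow_succ, ih, ← Matrix.mul_kronecker_mul, ← pow_succ, ← pow_succ]
  have e : jordanBlock F r ⊗ₖ jordanBlock F s - 1 =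
      (jordanBlock F r - 1) ⊗ₖ jordanBlock F s + 1 ⊗ₖ (jordanBlock F s - 1) := by
    rw [← Matrix.one_kronecker_one]
    ext ⟨i, j⟩ ⟨i', j'⟩
    simp only [Matrix.sub_apply, Matrix.add_apply, Matrix.kroneckerMap_apply]
    ring
  rw [e]
  apply Commute.isNilpotent_add
  · change _ * _ = _ * _
    rw [← Matrix.mul_kronecker_mul, ← Matrix.mul_kronecker_mul]
    simp [mul_sub, sub_mul]
  · exact ⟨r, by rw [hpow, hn]; simp⟩
  · exact ⟨s, by rw [hpow, hn]; simp⟩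

theorem exists_basis_adjoinRoot_X_pow (F : Type*) [Field F] (k : ℕ) :
    ∃ b : Module.Basis (Fin k) F (AdjoinRoot ((Polynomial.X : Polynomial F) ^ k)),
      ∀ a, b a = AdjoinRoot.mk _ (Polynomial.X ^ (k - 1 - (a : ℕ))) := by
  refine ⟨(AdjoinRoot.powerBasis' (Polynomial.monic_X_pow (R := F) k)).basis.reindex
      ((finCongr (by simp)).trans Fin.revPerm), fun a => ?_⟩
  simp only [Module.Basis.reindex_apply, PowerBasis.coe_basis]
  rw [show (AdjoinRoot.powerBasis' (Polynomial.monic_X_pow (R := F) k)).gen =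
    AdjoinRoot.mk (Polynomial.X ^ k) Polynomial.X from rfl, ← map_pow]
  congr 2
  simp [Fin.val_rev]
  omega

theorem dfinsupp_basis_apply {F ι : Type*} [Field F] [DecidableEq ι] {κ V : ι → Type*}
    [∀ i, AddCommGroup (V i)] [∀ i, Module F (V i)] (b : ∀ i, Module.Basis (κ i) F (V i))
    (i : ι) (a : κ i) : DFinsupp.basis b ⟨i, a⟩ = DFinsupp.single i (b i a) := by
  classical
  apply (DFinsupp.basis b).repr.injective
  rw [Module.Basis.repr_self]
  apply (sigmaFinsuppLequivDFinsupp F).injective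
  simp [DFinsupp.basis, sigmaFinsuppEquivDFinsupp_single]

theorem exists_blockDiagonal_of_isNilpotent {F : Type*} [Field F] {m : Type*} [Fintype m]
    [DecidableEq m] (M : Matrix m m F) (hM : IsNilpotent (M - 1)) :
    ∃ (d : ℕ) (k : Fin d → ℕ) (P : Matrix m (Σ i, Fin (k i)) F)
      (Q : Matrix (Σ i, Fin (k i)) m F),
      P * Q = 1 ∧ Q * P = 1 ∧ Q * M * P = Matrix.blockDiagonal' fun i => jordanBlock F (k i) := by
  classical
  obtain ⟨n, hn⟩ := hM
  let φ : Module.End F (m → F) := Matrix.toLin' (M - 1)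
  have hφ : φ ^ n = 0 := by rw [← Matrix.toLin'_pow, hn, map_zero]
  have htor : Module.IsTorsion' (Module.AEval' φ) (Submonoid.powers (Polynomial.X : Polynomial F)) := by
    intro x
    refine ⟨⟨Polynomial.X ^ n, n, rfl⟩, ?_⟩
    obtain ⟨v, rfl⟩ := (Module.AEval'.of φ).surjective x
    change (Polynomial.X ^ n : Polynomial F) • (Module.AEval'.of φ v) = 0
    rw [Module.AEval'.X_pow_smul_of, hφ]
    simp
  obtain ⟨d, k, ⟨e⟩⟩ := Module.torsion_by_prime_power_decomposition
    (Polynomial.irreducible_X (R := F)) htor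
  let e' := (Module.AEval'.of φ).trans (e.restrictScalars F)
  choose c0 hc0 using fun i : Fin d => exists_basis_adjoinRoot_X_pow F (k i)
  let b0 : ∀ i : Fin d, Module.Basis (Fin (k i)) F
      (Polynomial F ⧸ (Polynomial F ∙ (Polynomial.X : Polynomial F) ^ (k i))) := c0
  have hb0 : ∀ i (a : Fin (k i)), b0 i a =
      Submodule.Quotient.mk ((Polynomial.X : Polynomial F) ^ (k i - 1 - (a : ℕ))) := hc0
  have hX : ∀ i (a : Fin (k i)), (Polynomial.X : Polynomial F) • b0 i a =
      if h : 0 < (a : ℕ) then b0 i ⟨a - 1, by omega⟩ else 0 := by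
    intro i a
    rw [hb0, ← Submodule.Quotient.mk_smul, smul_eq_mul, ← pow_succ']
    split_ifs with h
    · rw [hb0]
      congr 2
      simp only
      omega
    · rw [Submodule.Quotient.mk_eq_zero, show k i - 1 - (a : ℕ) + 1 = k i by omega]
      exact Submodule.mem_span_singleton_self _
  let b : Module.Basis (Σ i, Fin (k i)) F (m → F) := (DFinsupp.basis b0).map e'.symm
  have heφ : ∀ v, e' (φ v) = (Polynomial.X : Polynomial F) • e' v := by
    intro v
    change e (Module.AEval'.of φ (φ v)) = (Polynomial.X : Polynomial F) • e (Module.AEval'.of φ v)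
    rw [← Module.AEval'.X_smul_of, map_smul]
  have hb : ∀ i a, e' (b ⟨i, a⟩) = DFinsupp.single i (b0 i a) := by
    intro i a
    simp only [b, Module.Basis.map_apply, LinearEquiv.apply_symm_apply]
    exact dfinsupp_basis_apply b0 i a
  have hφb : ∀ i (a : Fin (k i)), φ (b ⟨i, a⟩) =
      if h : 0 < (a : ℕ) then b ⟨i, ⟨a - 1, by omega⟩⟩ else 0 := by
    intro i a
    apply e'.injective
    rw [heφ, hb]
    have h1 : (Polynomial.X : Polynomial F) • (DFinsupp.single i (b0 i a) :
        Π₀ i, Polynomial F ⧸ (Polynomial F ∙ (Polynomial.X : Polynomial F) ^ (k i))) =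
        DFinsupp.single i ((Polynomial.X : Polynomial F) • b0 i a) :=
      (DFinsupp.single_smul _ _).symm
    refine h1.trans ?_
    rw [hX]
    split_ifs with h
    · rw [hb]
    · simp
  refine ⟨d, k, (Pi.basisFun F m).toMatrix b, b.toMatrix (Pi.basisFun F m),
    Module.Basis.toMatrix_mul_toMatrix_flip _ _, Module.Basis.toMatrix_mul_toMatrix_flip _ _, ?_⟩
  have hMφ : M = LinearMap.toMatrix (Pi.basisFun F m) (Pi.basisFun F m) (φ + 1) := by
    rw [LinearMap.toMatrix_eq_toMatrix', map_add, LinearMap.toMatrix'_toLin']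
    simp
  rw [hMφ, basis_toMatrix_mul_linearMap_toMatrix_mul_basis_toMatrix]
  ext ⟨i, a⟩ ⟨j, c⟩
  rw [LinearMap.toMatrix_apply, LinearMap.add_apply, hφb, Module.End.one_apply, map_add,
    Finsupp.add_apply]
  by_cases hij : i = j
  · subst hij
    rw [Matrix.blockDiagonal'_apply_eq]
    simp only [jordanBlock, Matrix.of_apply]
    split_ifs with h1 h2 h2 <;>
      simp only [Module.Basis.repr_self, Finsupp.single_apply, map_zero, Finsupp.zero_apply,
        Sigma.mk.injEq, true_and, heq_eq_eq, Fin.ext_iff] at * <;> split_ifs <;>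
      first | omega | simp
  · rw [Matrix.blockDiagonal'_apply_ne _ _ _ hij]
    split_ifs <;> simp [Module.Basis.repr_self, Ne.symm hij]

theorem exists_isJordanPartition (F : Type*) [Field F] {r s : ℕ} (h : r ≤ s) :
    ∃ lam : Fin r → ℕ, IsJordanPartition F r s lam := by
  rcases Nat.eq_zero_or_pos r with rfl | hr
  · exact ⟨Fin.elim0, fun i => i.elim0, fun i => i.elim0, 0, 0, by ext ⟨i, _⟩; exact i.elim0,
      by ext ⟨i, _⟩; exact i.elim0, by ext ⟨i, _⟩; exact i.elim0⟩
  obtain ⟨d, k, P, Q, h1, h2, h3⟩ := exists_blockDiagonal_of_isNilpotent _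
    (isNilpotent_kronecker_jordanBlock_sub_one F r s)
  have hcard : (Finset.univ.filter fun i => 0 < k i).card = r := by
    have a := card_lt_add_sum k 0
    have e0 := rank_blockDiagonal_sub_one_pow F k 0
    have e1 := rank_blockDiagonal_sub_one_pow F k 1
    rw [← rank_of_similar h1 h2 h3, pow_zero, Matrix.rank_one] at e0
    rw [← rank_of_similar h1 h2 h3, pow_one] at e1
    have e2 := (jordanBlock F r ⊗ₖ jordanBlock F s - 1).mulVecLin.finrank_range_add_finrank_ker
    rw [finrank_ker_kronecker_jordanBlock F hr h, Module.finrank_fintype_fun_eq_card] at e2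
    change (jordanBlock F r ⊗ₖ jordanBlock F s - 1).rank + r = _ at e2
    simp only [zero_add] at a
    omega
  have hc' : Fintype.card {i // 0 < k i} = r := by rw [Fintype.card_subtype, hcard]
  let g := (Fintype.equivFinOfCardEq hc').symm
  let f := (Fin.revPerm.trans (Tuple.sort fun i => k (g i))).trans g
  let lam : Fin r → ℕ := fun i => k (f i)
  have hanti : Antitone lam := by
    intro i j hij
    exact Tuple.monotone_sort (fun i => k (g i)) (Fin.rev_le_rev.2 hij)
  let G : (Σ i, Fin (lam i)) → Σ i, Fin (k i) := fun x => ⟨f x.1, x.2⟩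
  have hG : Function.Bijective G := by
    constructor
    · rintro ⟨i, a⟩ ⟨j, c⟩ hx
      simp only [G, Sigma.mk.injEq] at hx
      obtain ⟨hx1, hx2⟩ := hx
      obtain rfl : i = j := f.injective (Subtype.ext hx1)
      simpa using hx2
    · rintro ⟨i, a⟩
      obtain ⟨j, hj⟩ := f.surjective ⟨i, a.pos⟩
      have : (f j : Fin d) = i := by rw [hj]
      subst this
      exact ⟨⟨j, a⟩, rfl⟩
  let E := Equiv.ofBijective G hG
  refine ⟨lam, hanti, fun i => (f i).2, P.submatrix id E, Q.submatrix E id, ?_, ?_, ?_⟩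
  · rw [Matrix.submatrix_mul_equiv, h1]; simp
  · have := Matrix.submatrix_mul Q P E (id : _ → _) E Function.bijective_id
    rw [← this, h2]; simp
  · have e : Q.submatrix E id * (jordanBlock F r ⊗ₖ jordanBlock F s) * P.submatrix id E =
        (Q * (jordanBlock F r ⊗ₖ jordanBlock F s) * P).submatrix E E := by
      ext x y
      simp [Matrix.mul_apply]
    rw [e, h3]
    ext ⟨i, a⟩ ⟨j, c⟩
    by_cases hij : i = j
    · subst hij
      rw [Matrix.submatrix_apply, Matrix.blockDiagonal'_apply_eq]
      exact Matrix.blockDiagonal'_apply_eq _ _ _ _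
    · rw [Matrix.submatrix_apply, Matrix.blockDiagonal'_apply_ne _ _ _ hij]
      exact Matrix.blockDiagonal'_apply_ne _ _ _ fun hh => hij (f.injective (Subtype.ext hh))

/-- The Jordan partition `λ = (λ_1, …, λ_r)` of `J_r ⊗ J_s` over `F`, for `r ≤ s`. It exists and is
unique, see `exists_isJordanPartition` and `IsJordanPartition.unique`. -/
noncomputable def jordanPartition (F : Type u) [Field F] {r s : ℕ} (h : r ≤ s) : Fin r → ℕ :=
  (exists_isJordanPartition F h).choose

theorem isJordanPartition_iff (F : Type u) [Field F] {r s : ℕ} (h : r ≤ s) (lam : Fin r → ℕ) :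
    IsJordanPartition F r s lam ↔ lam = jordanPartition F h := by
  have hs : IsJordanPartition F r s (jordanPartition F h) :=
    (exists_isJordanPartition F h).choose_spec
  exact ⟨fun h' => h'.unique hs, fun h' => h' ▸ hs⟩

/-- The deviation vector `ε = (λ_1 - s, …, λ_r - s)` over `F`, for `r ≤ s`. -/
noncomputable def deviationVector (F : Type u) [Field F] {r s : ℕ} (h : r ≤ s) : Fin r → ℤ :=
  fun i => (jordanPartition F h i : ℤ) - (s : ℤ)

end JordanTensor

/-! Number the parts of λ from 0. After a transposition and the substitution y ↦ (1 + x)y, `J_r ⊗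
J_s - 1` becomes multiplication by z = x + y on A = F[x, y]/(x^r, y^s): a nilpotent operator,
homogeneous of degree one, with Jordan block sizes λ_j (`IsJordanPartition.rank_mulXAddY_pow`).

Setting y = -x identifies A/zA with F[x]/(x^r), which has one dimension in each degree 0, …, r - 1.
The kernel of z lives in degrees s - 1, …, s + r - 2, with at most one dimension in each. The image
of ker z^m in A/zA has dimension at least #{i | λ_i ≤ m}. Multiplication by x commutes with z and
raises degrees, so for every j there is a generator g_j, homogeneous of degree j and killed by
z^{λ_j} (`IsJordanPartition.exists_homogeneous_generator`). By a Nakayama argument and a dimension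
count, the vectors z^k g_j with k < λ_j form a basis
(`IsJordanPartition.linearIndependent_strings`). The ends z^{λ_j - 1} g_j are then independent
kernel elements of degree λ_j + j - 1, so σ(j) = λ_j - s + j is a permutation of {0, …, r - 1}.

As λ is antitone, σ(j + 1) ≤ σ(j) + 1. A permutation with this property is determined by its set of
descents, a subset of r - 1 positions (`finite_and_ncard_le_of_antitone`). -/

namespace JordanTensor

/-! ### Multiplication by x + y on F[x, y]/(x^r, y^s) -/

/-- The matrix with ones directly below the diagonal and zeros elsewhere. -/
def lowerShift (F : Type*) [Field F] (n : ℕ) : Matrix (Fin n) (Fin n) F :=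
  Matrix.of fun i j => if (i : ℕ) = j + 1 then 1 else 0

theorem lowerShift_mulVec (F : Type*) [Field F] (n : ℕ) (w : Fin n → F) (i : Fin n) :
    (lowerShift F n).mulVec w i = if h : 0 < (i : ℕ) then w ⟨i - 1, by omega⟩ else 0 := by
  simp only [Matrix.mulVec, dotProduct, lowerShift, Matrix.of_apply, ite_mul, one_mul, zero_mul]
  split_ifs with h
  · rw [Finset.sum_eq_single (⟨i - 1, by omega⟩ : Fin n)]
    · rw [if_pos (by simp only; omega)]
    · intro b _ hb
      exact if_neg fun hh => hb (Fin.ext (by simp only; omega))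
    · simp
  · exact Finset.sum_eq_zero fun b _ => if_neg (by omega)

theorem lowerShift_transpose_mulVec (F : Type*) [Field F] (n : ℕ) (w : Fin n → F) (i : Fin n) :
    (lowerShift F n).transpose.mulVec w i = if h : (i : ℕ) + 1 < n then w ⟨i + 1, h⟩ else 0 := by
  simp only [Matrix.mulVec, dotProduct, lowerShift, Matrix.transpose_apply, Matrix.of_apply,
    ite_mul, one_mul, zero_mul]
  split_ifs with h
  · rw [Finset.sum_eq_single (⟨i + 1, h⟩ : Fin n)]
    · rw [if_pos rfl]
    · intro b _ hb
      exact if_neg fun hh => hb (Fin.ext hh)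
    · simp
  · exact Finset.sum_eq_zero fun b _ => if_neg (by omega)

theorem transpose_jordanBlock (F : Type*) [Field F] (n : ℕ) :
    (jordanBlock F n).transpose = 1 + lowerShift F n := by
  ext i j
  simp only [jordanBlock, lowerShift, Matrix.transpose_apply, Matrix.of_apply, Matrix.add_apply,
    Matrix.one_apply, Fin.ext_iff]
  split_ifs <;> first | omega | simp

theorem kronecker_one_mulVec {F m n : Type*} [Field F] [Fintype m] [Fintype n] [DecidableEq n]
    (A : Matrix m m F) (v : m × n → F) (x : m × n) :
    (A ⊗ₖ (1 : Matrix n n F)).mulVec v x = A.mulVec (fun i => v (i, x.2)) x.1 := by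
  simp [Matrix.mulVec, dotProduct, Fintype.sum_prod_type, Matrix.one_apply]

theorem one_kronecker_mulVec {F m n : Type*} [Field F] [Fintype m] [Fintype n] [DecidableEq m]
    (A : Matrix n n F) (v : m × n → F) (x : m × n) :
    ((1 : Matrix m m F) ⊗ₖ A).mulVec v x = A.mulVec (fun j => v (x.1, j)) x.2 := by
  simp [Matrix.mulVec, dotProduct, Fintype.sum_prod_type_right, Matrix.one_apply]

/-- Multiplication by `x` on `F[x, y] / (x ^ r, y ^ s)` in the basis of monomials. -/
def mulX (F : Type*) [Field F] (r s : ℕ) : Matrix (Fin r × Fin s) (Fin r × Fin s) F :=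
  lowerShift F r ⊗ₖ 1

/-- Multiplication by `x + y` on `F[x, y] / (x ^ r, y ^ s)` in the basis of monomials. -/
def mulXAddY (F : Type*) [Field F] (r s : ℕ) : Matrix (Fin r × Fin s) (Fin r × Fin s) F :=
  mulX F r s + 1 ⊗ₖ lowerShift F s

theorem commute_mulX_mulXAddY (F : Type*) [Field F] (r s : ℕ) :
    Commute (mulX F r s) (mulXAddY F r s) := by
  refine (Commute.refl _).add_right ?_
  change _ * _ = _ * _
  simp [mulX, ← Matrix.mul_kronecker_mul]

theorem mulX_mulVec {F : Type*} [Field F] {r s : ℕ} (v : Fin r × Fin s → F) (x : Fin r × Fin s) :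
    (mulX F r s).mulVec v x = if h : 0 < (x.1 : ℕ) then v (⟨x.1 - 1, by omega⟩, x.2) else 0 := by
  rw [mulX, kronecker_one_mulVec, lowerShift_mulVec]

theorem mulXAddY_mulVec {F : Type*} [Field F] {r s : ℕ} (v : Fin r × Fin s → F)
    (x : Fin r × Fin s) :
    (mulXAddY F r s).mulVec v x =
      (if h : 0 < (x.1 : ℕ) then v (⟨x.1 - 1, by omega⟩, x.2) else 0) +
      if h : 0 < (x.2 : ℕ) then v (x.1, ⟨x.2 - 1, by omega⟩) else 0 := by
  rw [mulXAddY, Matrix.add_mulVec, Pi.add_apply, mulX_mulVec, one_kronecker_mulVec,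
    lowerShift_mulVec]

/-- The transpose acts as (1 + x)(1 + y) = 1 + x + (1 + x)y. As 1 + x is a unit, y ↦ (1 + x)y is an
automorphism; its matrix `P` has the block (1 + x)^j on the span of the monomials x^i y^j, j fixed.
-/
theorem transpose_kronecker_jordanBlock_similar (F : Type*) [Field F] (r s : ℕ) :
    ∃ P Q : Matrix (Fin r × Fin s) (Fin r × Fin s) F, P * Q = 1 ∧ Q * P = 1 ∧
      Q * (jordanBlock F r ⊗ₖ jordanBlock F s).transpose * P = 1 + mulXAddY F r s := by
  obtain ⟨U, hU⟩ := (Matrix.isUnit_transpose (A := jordanBlock F r)).2 (jordanBlock_isUnit F r)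
  let P : Matrix (Fin r × Fin s) (Fin r × Fin s) F :=
    Matrix.blockDiagonal fun j : Fin s => ((U ^ (j : ℕ) : _ˣ) : Matrix (Fin r) (Fin r) F)
  let Q : Matrix (Fin r × Fin s) (Fin r × Fin s) F :=
    Matrix.blockDiagonal fun j : Fin s => (((U ^ (j : ℕ))⁻¹ : _ˣ) : Matrix (Fin r) (Fin r) F)
  have hPQ : P * Q = 1 := by
    simp only [P, Q]
    rw [← Matrix.blockDiagonal_mul]
    simp only [Units.mul_inv]
    exact Matrix.blockDiagonal_one
  have hQP : Q * P = 1 := by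
    simp only [P, Q]
    rw [← Matrix.blockDiagonal_mul]
    simp only [Units.inv_mul]
    exact Matrix.blockDiagonal_one
  refine ⟨P, Q, hPQ, hQP, ?_⟩
  have key : (jordanBlock F r ⊗ₖ jordanBlock F s).transpose * P = P * (1 + mulXAddY F r s) := by
    have e1 : (1 : Matrix _ _ F) + mulXAddY F r s =
        (U : Matrix (Fin r) (Fin r) F) ⊗ₖ 1 + 1 ⊗ₖ lowerShift F s := by
      rw [hU, transpose_jordanBlock, Matrix.add_kronecker, Matrix.one_kronecker_one, mulXAddY,
        mulX, add_assoc]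
    have e2 : (jordanBlock F r ⊗ₖ jordanBlock F s).transpose =
        (U : Matrix (Fin r) (Fin r) F) ⊗ₖ (1 + lowerShift F s) := by
      rw [hU, ← transpose_jordanBlock]
      rfl
    rw [e1, e2]
    ext ⟨i, j⟩ ⟨i', j'⟩
    have l1 : (((U : Matrix (Fin r) (Fin r) F) ⊗ₖ (1 + lowerShift F s) * P :
        Matrix (Fin r × Fin s) (Fin r × Fin s) F)) (i, j) (i', j') =
        (1 + lowerShift F s) j j' * ((U ^ ((j' : ℕ) + 1) : _ˣ) : Matrix (Fin r) (Fin r) F) i i' := by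
      rw [pow_succ', Units.val_mul, Matrix.mul_apply, Matrix.mul_apply, Fintype.sum_prod_type,
        Finset.mul_sum]
      refine Finset.sum_congr rfl fun a _ => ?_
      simp only [P, Matrix.kroneckerMap_apply, Matrix.blockDiagonal_apply, mul_ite, mul_zero,
        Finset.sum_ite_eq', Finset.mem_univ, if_true]
      ring
    have l2 : ((P * (U : Matrix (Fin r) (Fin r) F) ⊗ₖ 1 :
        Matrix (Fin r × Fin s) (Fin r × Fin s) F)) (i, j) (i', j') =
        (1 : Matrix (Fin s) (Fin s) F) j j' *
          ((U ^ ((j : ℕ) + 1) : _ˣ) : Matrix (Fin r) (Fin r) F) i i' := by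
      rw [pow_succ, Units.val_mul, Matrix.mul_apply, Matrix.mul_apply, Fintype.sum_prod_type,
        Finset.mul_sum]
      refine Finset.sum_congr rfl fun a _ => ?_
      simp only [P, Matrix.kroneckerMap_apply, Matrix.blockDiagonal_apply, ite_mul, zero_mul,
        Finset.sum_ite_eq, Finset.mem_univ, if_true]
      ring
    have l3 : (P * (1 : Matrix (Fin r) (Fin r) F) ⊗ₖ lowerShift F s) (i, j) (i', j') =
        lowerShift F s j j' * ((U ^ (j : ℕ) : _ˣ) : Matrix (Fin r) (Fin r) F) i i' := by
      simp only [P, Matrix.mul_apply, Fintype.sum_prod_type, Matrix.kroneckerMap_apply,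
        Matrix.blockDiagonal_apply, ite_mul, zero_mul, Finset.sum_ite_eq, Finset.mem_univ, if_true]
      simp [Matrix.one_apply, mul_comm]
    rw [Matrix.mul_add, Matrix.add_apply, l1, l2, l3, Matrix.add_apply, add_mul]
    congr 1
    · by_cases h : j = j'
      · rw [h]
      · simp [h]
    · simp only [lowerShift, Matrix.of_apply]
      split_ifs with h
      · rw [h]
      · simp
  rw [Matrix.mul_assoc, key, ← Matrix.mul_assoc, hQP, Matrix.one_mul]

/-- Only ranks of powers are needed later, and these do not see the transposition. -/
theorem IsJordanPartition.rank_mulXAddY_pow {F : Type*} [Field F] {r s : ℕ} {lam : Fin r → ℕ}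
    (h : IsJordanPartition F r s lam) (k : ℕ) :
    (mulXAddY F r s ^ k).rank = ∑ i, (lam i - k) := by
  obtain ⟨P, Q, h1, h2, h3⟩ := h.similar
  obtain ⟨P', Q', h1', h2', h3'⟩ := transpose_kronecker_jordanBlock_similar F r s
  have e := rank_of_similar h1' h2' h3' k
  rw [add_sub_cancel_left] at e
  rw [← rank_blockDiagonal_sub_one_pow F, ← rank_of_similar h1 h2 h3, ← e, ← Matrix.rank_transpose,
    Matrix.transpose_pow, Matrix.transpose_sub, Matrix.transpose_transpose, Matrix.transpose_one]

/-! ### The grading by total degree -/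

/-- The homogeneous component of degree `d` of an element of `F[x, y] / (x ^ r, y ^ s)`. -/
def homogPart (F : Type*) [Field F] (r s d : ℕ) : Module.End F (Fin r × Fin s → F) where
  toFun v x := if (x.1 : ℕ) + x.2 = d then v x else 0
  map_add' v w := by ext x; simp only [Pi.add_apply]; split_ifs <;> simp
  map_smul' c v := by ext x; simp

theorem homogPart_apply {F : Type*} [Field F] {r s d : ℕ} (v : Fin r × Fin s → F)
    (x : Fin r × Fin s) :
    homogPart F r s d v x = if (x.1 : ℕ) + x.2 = d then v x else 0 := rfl

theorem apply_eq_zero_of_homogPart_eq {F : Type*} [Field F] {r s d : ℕ} {v : Fin r × Fin s → F}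
    (hv : homogPart F r s d v = v) {x : Fin r × Fin s} (hx : (x.1 : ℕ) + x.2 ≠ d) : v x = 0 := by
  rw [← hv, homogPart_apply, if_neg hx]

theorem homogPart_homogPart {F : Type*} [Field F] {r s d : ℕ} (v : Fin r × Fin s → F) :
    homogPart F r s d (homogPart F r s d v) = homogPart F r s d v := by
  ext x
  simp only [homogPart_apply]
  split_ifs <;> rfl

theorem homogPart_mulX {F : Type*} [Field F] {r s : ℕ} (d : ℕ) (v : Fin r × Fin s → F) :
    homogPart F r s (d + 1) ((mulX F r s).mulVec v) = (mulX F r s).mulVec (homogPart F r s d v) := by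
  ext x
  simp only [homogPart_apply, mulX_mulVec]
  split_ifs <;> first | rfl | omega

theorem homogPart_mulXAddY {F : Type*} [Field F] {r s : ℕ} (d : ℕ) (v : Fin r × Fin s → F) :
    homogPart F r s (d + 1) ((mulXAddY F r s).mulVec v) =
      (mulXAddY F r s).mulVec (homogPart F r s d v) := by
  ext x
  simp only [homogPart_apply, mulXAddY_mulVec]
  split_ifs <;> first | rfl | omega | simp

theorem homogPart_mulX_pow {F : Type*} [Field F] {r s : ℕ} (d k : ℕ) (v : Fin r × Fin s → F) :
    homogPart F r s (d + k) ((mulX F r s ^ k).mulVec v) =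
      (mulX F r s ^ k).mulVec (homogPart F r s d v) := by
  induction k with
  | zero => simp
  | succ k ih => rw [pow_succ', ← Matrix.mulVec_mulVec, ← add_assoc, homogPart_mulX, ih,
      Matrix.mulVec_mulVec]

theorem homogPart_mulXAddY_pow {F : Type*} [Field F] {r s : ℕ} (d k : ℕ)
    (v : Fin r × Fin s → F) :
    homogPart F r s (d + k) ((mulXAddY F r s ^ k).mulVec v) =
      (mulXAddY F r s ^ k).mulVec (homogPart F r s d v) := by
  induction k with
  | zero => simp
  | succ k ih => rw [pow_succ', ← Matrix.mulVec_mulVec, ← add_assoc, homogPart_mulXAddY, ih,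
      Matrix.mulVec_mulVec]

/-! ### The cokernel of x + y: substituting y = -x -/

/-- The coefficient vector of the functional that sends `f` to the coefficient of `x ^ c` in
`f(x, -x)`. -/
def evalCoeff (F : Type*) [Field F] (r s c : ℕ) : Fin r × Fin s → F :=
  fun x => if (x.1 : ℕ) + x.2 = c then (-1) ^ (x.2 : ℕ) else 0

/-- The map `f(x, y) ↦ f(x, -x)` from `F[x, y] / (x ^ r, y ^ s)` to `F[x] / (x ^ r)`, `r ≤ s`. -/
def evalNeg (F : Type*) [Field F] (r s : ℕ) : (Fin r × Fin s → F) →ₗ[F] (Fin r → F) :=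
  (Matrix.of fun c : Fin r => evalCoeff F r s c).mulVecLin

theorem evalNeg_apply {F : Type*} [Field F] {r s : ℕ} (v : Fin r × Fin s → F) (c : Fin r) :
    evalNeg F r s v c = evalCoeff F r s c ⬝ᵥ v := rfl

theorem evalCoeff_vecMul_mulX {F : Type*} [Field F] {r s c : ℕ} (hc : c + 1 < r) :
    Matrix.vecMul (evalCoeff F r s (c + 1)) (mulX F r s) = evalCoeff F r s c := by
  ext x
  rw [← Matrix.mulVec_transpose, mulX, ← Matrix.kroneckerMap_transpose, Matrix.transpose_one,
    kronecker_one_mulVec, lowerShift_transpose_mulVec]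
  simp only [evalCoeff]
  split_ifs <;> first | rfl | omega

/-- The two terms cancel because x + y vanishes at y = -x; c < r ≤ s keeps the truncations x^r = 0
and y^s = 0 out of degree c. -/
theorem evalCoeff_vecMul_mulXAddY {F : Type*} [Field F] {r s c : ℕ} (hc : c < r) (h : r ≤ s) :
    Matrix.vecMul (evalCoeff F r s c) (mulXAddY F r s) = 0 := by
  ext x
  rw [mulXAddY, Matrix.vecMul_add, mulX, Pi.add_apply, ← Matrix.mulVec_transpose,
    ← Matrix.mulVec_transpose, ← Matrix.kroneckerMap_transpose, ← Matrix.kroneckerMap_transpose,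
    Matrix.transpose_one, Matrix.transpose_one, kronecker_one_mulVec, one_kronecker_mulVec,
    lowerShift_transpose_mulVec, lowerShift_transpose_mulVec]
  simp only [evalCoeff, Pi.zero_apply]
  split_ifs <;> first | omega | simp [pow_succ]

theorem evalCoeff_dotProduct_homogPart {F : Type*} [Field F] {r s : ℕ} (c d : ℕ)
    (v : Fin r × Fin s → F) :
    evalCoeff F r s c ⬝ᵥ homogPart F r s d v = if c = d then evalCoeff F r s c ⬝ᵥ v else 0 := by
  simp only [dotProduct, evalCoeff, homogPart_apply]
  split_ifs with h
  · subst h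
    refine Finset.sum_congr rfl fun x _ => ?_
    split_ifs <;> simp
  · refine Finset.sum_eq_zero fun x _ => ?_
    split_ifs <;> first | omega | simp

theorem evalCoeff_dotProduct_mulX_pow {F : Type*} [Field F] {r s c k : ℕ} (hc : c + k < r)
    (v : Fin r × Fin s → F) :
    evalCoeff F r s (c + k) ⬝ᵥ (mulX F r s ^ k).mulVec v = evalCoeff F r s c ⬝ᵥ v := by
  induction k with
  | zero => simp
  | succ k ih => rw [pow_succ', ← Matrix.mulVec_mulVec, Matrix.dotProduct_mulVec, ← add_assoc,
      evalCoeff_vecMul_mulX (by omega), ih (by omega)]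

theorem evalNeg_surjective (F : Type*) [Field F] {r s : ℕ} (h : r ≤ s) :
    Function.Surjective (evalNeg F r s) := by
  intro w
  rcases Nat.eq_zero_or_pos r with rfl | hr
  · exact ⟨0, Subsingleton.elim _ _⟩
  -- A polynomial in x alone serves as preimage.
  refine ⟨fun x => if (x.2 : ℕ) = 0 then w x.1 else 0, ?_⟩
  ext c
  rw [evalNeg_apply, dotProduct, Finset.sum_eq_single (c, (⟨0, by omega⟩ : Fin s))]
  · simp [evalCoeff]
  · rintro ⟨i, j⟩ - hx
    simp only [evalCoeff]
    split_ifs with h1 h2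
    · exact absurd (Prod.ext (Fin.ext (by simp only; omega)) (Fin.ext h2)) hx
    all_goals simp
  · simp

theorem evalNeg_mulXAddY {F : Type*} [Field F] {r s : ℕ} (h : r ≤ s) (v : Fin r × Fin s → F) :
    evalNeg F r s ((mulXAddY F r s).mulVec v) = 0 := by
  ext c
  rw [evalNeg_apply, Matrix.dotProduct_mulVec, evalCoeff_vecMul_mulXAddY c.2 h, zero_dotProduct]
  rfl

/-! ### The kernel of x + y -/

/-- The coefficient of x^i y^(j+1) in (x + y)v is v_(i-1,j+1) + v_(i,j), so by induction on i a
kernel element is determined by its coefficients at y^(s-1). -/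
theorem eq_zero_of_mulXAddY_mulVec_eq_zero {F : Type*} [Field F] {r s : ℕ}
    {v : Fin r × Fin s → F} (hv : (mulXAddY F r s).mulVec v = 0)
    (h0 : ∀ x, (x.2 : ℕ) + 1 = s → v x = 0) : v = 0 := by
  have key : ∀ (i : ℕ) (hi : i < r) (j : Fin s), v (⟨i, hi⟩, j) = 0 := by
    intro i
    induction i with
    | zero =>
      intro hi j
      by_cases hj : (j : ℕ) + 1 = s
      · exact h0 _ hj
      · simpa [mulXAddY_mulVec] using congrFun hv (⟨0, hi⟩, ⟨j + 1, by omega⟩)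
    | succ i ih =>
      intro hi j
      by_cases hj : (j : ℕ) + 1 = s
      · exact h0 _ hj
      · simpa [mulXAddY_mulVec, ih] using congrFun hv (⟨i + 1, hi⟩, ⟨j + 1, by omega⟩)
  ext ⟨i, j⟩
  exact key i i.2 j

/-- The degrees of the homogeneous elements of the kernel of multiplication by `x + y`. -/
theorem exists_apply_ne_zero_of_homogPart_eq {F : Type*} [Field F] {r s d : ℕ}
    {v : Fin r × Fin s → F} (hv : (mulXAddY F r s).mulVec v = 0) (hd : homogPart F r s d v = v)
    (h0 : v ≠ 0) : ∃ x : Fin r × Fin s, (x.2 : ℕ) + 1 = s ∧ (x.1 : ℕ) + x.2 = d ∧ v x ≠ 0 := by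
  by_contra! hx
  exact h0 (eq_zero_of_mulXAddY_mulVec_eq_zero hv fun x hxs => by
    by_cases hxd : (x.1 : ℕ) + x.2 = d
    · exact hx x hxs hxd
    · exact apply_eq_zero_of_homogPart_eq hd hxd)

theorem not_linearIndependent_of_homogPart_eq {F : Type*} [Field F] {r s d : ℕ}
    {v w : Fin r × Fin s → F} (hv : (mulXAddY F r s).mulVec v = 0)
    (hw : (mulXAddY F r s).mulVec w = 0) (hdv : homogPart F r s d v = v)
    (hdw : homogPart F r s d w = w) : ¬ LinearIndependent F ![v, w] := by
  intro hli
  obtain ⟨x, hx1, hx2, hx3⟩ := exists_apply_ne_zero_of_homogPart_eq hv hdv (hli.ne_zero 0)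
  -- This combination cancels at `x`, the only monomial of degree d divisible by y^(s-1).
  have hz : w x • v + (-v x) • w = 0 := by
    apply eq_zero_of_mulXAddY_mulVec_eq_zero
    · rw [Matrix.mulVec_add, Matrix.mulVec_smul, Matrix.mulVec_smul, hv, hw]
      simp
    · intro y hy
      by_cases hyd : (y.1 : ℕ) + y.2 = d
      · obtain rfl : y = x := Prod.ext (Fin.ext (by omega)) (Fin.ext (by omega))
        simp only [Pi.add_apply, Pi.smul_apply, smul_eq_mul]
        ring
      · simp [apply_eq_zero_of_homogPart_eq hdv hyd, apply_eq_zero_of_homogPart_eq hdw hyd]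
  exact hx3 (neg_eq_zero.1 (LinearIndependent.pair_iff.1 hli _ _ hz).2)

/-! ### Permutations determined by their descents -/

/-- Once a sequence with steps at most one that avoids its values has descended, it stays below. -/
theorem lt_of_descent {n : ℕ} {σ : Fin (n + 1) → ℤ} (hinj : Function.Injective σ)
    (hstep : ∀ i : Fin n, σ i.succ ≤ σ i.castSucc + 1) {i : Fin n}
    (hi : σ i.succ < σ i.castSucc) {j : Fin (n + 1)} (hij : i.castSucc < j) :
    σ j < σ i.castSucc := by
  induction j using Fin.induction with
  | zero => simp at hij
  | succ j ih =>
    rcases (Fin.castSucc_lt_succ_iff.1 hij).eq_or_lt with rfl | h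
    · exact hi
    · have h1 := ih (Fin.castSucc_lt_castSucc_iff.2 h)
      have h2 := hstep j
      -- A step of at most one cannot climb past σ(i) without hitting it.
      have h3 : σ j.succ ≠ σ i.castSucc := hinj.ne hij.ne'
      omega

/-- Descents determine all inversions. A descent at i is inverted with every later j; otherwise σ(i
+ 1) = σ(i) + 1, and since σ(j) ≠ σ(i), comparing σ(j) with σ(i) amounts to comparing it with σ(i +
1). -/
theorem lt_iff_lt_of_descents {n : ℕ} {σ τ : Fin (n + 1) → ℤ} (hσ : Function.Injective σ)
    (hτ : Function.Injective τ) (hσs : ∀ i : Fin n, σ i.succ ≤ σ i.castSucc + 1)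
    (hτs : ∀ i : Fin n, τ i.succ ≤ τ i.castSucc + 1)
    (hd : ∀ i : Fin n, σ i.succ < σ i.castSucc ↔ τ i.succ < τ i.castSucc)
    {i j : Fin (n + 1)} (hij : i < j) : σ j < σ i ↔ τ j < τ i := by
  induction i using Fin.reverseInduction with
  | last => exact absurd hij (Fin.le_last j).not_gt
  | cast i ih =>
    by_cases h : σ i.succ < σ i.castSucc
    · exact iff_of_true (lt_of_descent hσ hσs h hij) (lt_of_descent hτ hτs ((hd i).1 h) hij)
    · have h' := mt (hd i).2 h
      have a1 := hσs i
      have a2 := hτs i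
      have b1 : σ i.succ ≠ σ i.castSucc := hσ.ne Fin.castSucc_lt_succ.ne'
      have b2 : τ i.succ ≠ τ i.castSucc := hτ.ne Fin.castSucc_lt_succ.ne'
      rcases (Fin.castSucc_lt_iff_succ_le.1 hij).eq_or_lt with rfl | h1
      · omega
      · have c := ih h1
        have c1 : σ j ≠ σ i.castSucc := hσ.ne hij.ne'
        have c2 : τ j ≠ τ i.castSucc := hτ.ne hij.ne'
        omega

theorem eq_of_lt_iff_lt {r : ℕ} {σ τ : Fin r → ℤ} (hσ : Function.Injective σ)
    (hτ : Function.Injective τ) (hσr : ∀ i, σ i ∈ Set.Ico (0 : ℤ) r)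
    (hτr : ∀ i, τ i ∈ Set.Ico (0 : ℤ) r) (h : ∀ i j, i < j → (σ j < σ i ↔ τ j < τ i)) :
    σ = τ := by
  have hlt : ∀ i j, σ j < σ i ↔ τ j < τ i := by
    intro i j
    rcases lt_trichotomy i j with hij | rfl | hij
    · exact h i j hij
    · simp
    · have a := h j i hij
      have b1 := hσ.ne hij.ne
      have b2 := hτ.ne hij.ne
      omega
  -- A value of a permutation of {0, …, r - 1} is the number of smaller values, hence recoverable
  -- from the order relations.
  have hcard : ∀ ρ : Fin r → ℤ, Function.Injective ρ → (∀ i, ρ i ∈ Set.Ico (0 : ℤ) r) →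
      ∀ i, ((Finset.univ.filter fun j => ρ j < ρ i).card : ℤ) = ρ i := by
    intro ρ hρ hρr i
    have himg : Finset.univ.image ρ = Finset.Ico (0 : ℤ) r := by
      apply Finset.eq_of_subset_of_card_le
      · intro x hx
        obtain ⟨i, -, rfl⟩ := Finset.mem_image.1 hx
        exact Finset.mem_Ico.2 (hρr i)
      · rw [Finset.card_image_of_injective _ hρ]
        simp
    have himg' : (Finset.univ.filter fun j => ρ j < ρ i).image ρ = Finset.Ico (0 : ℤ) (ρ i) := by
      ext x
      have hx : x ∈ Finset.univ.image ρ ↔ x ∈ Finset.Ico (0 : ℤ) r := by rw [himg]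
      have := hρr i
      simp only [Finset.mem_image, Finset.mem_filter, Finset.mem_univ, true_and, Finset.mem_Ico,
        Set.mem_Ico] at hx this ⊢
      constructor
      · rintro ⟨j, hj, rfl⟩
        exact ⟨(hρr j).1, hj⟩
      · rintro ⟨h0, h1⟩
        obtain ⟨j, rfl⟩ := hx.2 ⟨h0, h1.trans this.2⟩
        exact ⟨j, h1, rfl⟩
    rw [← Finset.card_image_of_injective _ hρ, himg', Int.card_Ico, sub_zero,
      Int.toNat_of_nonneg (hρr i).1]
  funext i
  rw [← hcard σ hσ hσr i, ← hcard τ hτ hτr i]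
  simp only [hlt]

/-- The antitone integer vectors `ε` such that `i ↦ ε i + i` permutes `{0, …, r - 1}` are
determined by their descents. -/
theorem finite_and_ncard_le_of_antitone {n : ℕ} {S : Set (Fin (n + 1) → ℤ)}
    (hS : ∀ ε ∈ S, Antitone ε ∧ Function.Injective (fun i => ε i + ((i : ℕ) : ℤ)) ∧
      ∀ i, ε i + ((i : ℕ) : ℤ) ∈ Set.Ico (0 : ℤ) (n + 1 : ℕ)) :
    S.Finite ∧ S.ncard ≤ 2 ^ n := by
  let D : (Fin (n + 1) → ℤ) → (Fin n → Prop) :=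
    fun ε i => ε i.succ + (i + 1 : ℕ) < ε i.castSucc + (i : ℕ)
  have hD : Set.InjOn D S := by
    intro ε hε δ hδ h
    obtain ⟨a1, b1, c1⟩ := hS ε hε
    obtain ⟨a2, b2, c2⟩ := hS δ hδ
    have e := eq_of_lt_iff_lt b1 b2 c1 c2 fun i j hij => lt_iff_lt_of_descents b1 b2 (fun i => by
        have := a1 (Fin.castSucc_lt_succ (i := i)).le
        simp only [Fin.val_succ, Fin.val_castSucc]; push_cast; omega) (fun i => by
        have := a2 (Fin.castSucc_lt_succ (i := i)).le
        simp only [Fin.val_succ, Fin.val_castSucc]; push_cast; omega)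
      (fun i => by simpa [D] using iff_of_eq (congrFun h i)) hij
    funext i
    simpa using congrFun e i
  refine ⟨Set.Finite.of_finite_image (Set.toFinite (D '' S)) hD, ?_⟩
  rw [← hD.ncard_image]
  calc (D '' S).ncard ≤ (Set.univ : Set (Fin n → Prop)).ncard := Set.ncard_le_ncard (Set.subset_univ _)
    _ = 2 ^ n := by rw [Set.ncard_univ, Nat.card_eq_fintype_card]; simp

/-! ### Dimension counts from the block sizes -/

theorem finrank_map_add_finrank_ker_inf {F V W : Type*} [Field F] [AddCommGroup V] [Module F V]
    [FiniteDimensional F V] [AddCommGroup W] [Module F W] (f : V →ₗ[F] W) (p : Submodule F V) :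
    Module.finrank F (p.map f) + Module.finrank F (p ⊓ LinearMap.ker f : Submodule F V) =
      Module.finrank F p := by
  rw [← (f.domRestrict p).finrank_range_add_finrank_ker, LinearMap.range_domRestrict,
    LinearMap.ker_domRestrict, ← Submodule.map_comap_subtype, Submodule.finrank_map_subtype_eq]

theorem IsJordanPartition.sum_eq {F : Type*} [Field F] {r s : ℕ} {lam : Fin r → ℕ}
    (h : IsJordanPartition F r s lam) : ∑ i, lam i = r * s := by
  simpa using (h.rank_mulXAddY_pow 0).symm

theorem IsJordanPartition.sum_sub_one {F : Type*} [Field F] {r s : ℕ} {lam : Fin r → ℕ}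
    (h : IsJordanPartition F r s lam) : r + ∑ i, (lam i - 1) = r * s := by
  have := card_lt_add_sum lam 0
  simpa [Finset.filter_true_of_mem fun i _ => h.pos i, h.sum_eq] using this

theorem IsJordanPartition.finrank_ker_pow {F : Type*} [Field F] {r s : ℕ} {lam : Fin r → ℕ}
    (h : IsJordanPartition F r s lam) (k : ℕ) :
    ∑ i, (lam i - k) + Module.finrank F (LinearMap.ker (mulXAddY F r s ^ k).mulVecLin) =
      r * s := by
  rw [← h.rank_mulXAddY_pow, Matrix.rank]
  have := (mulXAddY F r s ^ k).mulVecLin.finrank_range_add_finrank_ker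
  simpa using this

/-- The r blocks are nonempty, so x + y has rank rs - r, the dimension of the kernel of a surjection
onto F^r. -/
theorem IsJordanPartition.ker_evalNeg {F : Type*} [Field F] {r s : ℕ} {lam : Fin r → ℕ}
    (h : IsJordanPartition F r s lam) (hrs : r ≤ s) :
    LinearMap.ker (evalNeg F r s) = LinearMap.range (mulXAddY F r s).mulVecLin := by
  symm
  apply Submodule.eq_of_le_of_finrank_eq
  · rintro _ ⟨v, rfl⟩
    exact evalNeg_mulXAddY hrs v
  · have e1 := h.rank_mulXAddY_pow 1
    rw [pow_one, Matrix.rank] at e1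
    have e2 := (evalNeg F r s).finrank_range_add_finrank_ker
    rw [LinearMap.range_eq_top.2 (evalNeg_surjective F hrs), finrank_top] at e2
    simp only [Module.finrank_fintype_fun_eq_card, Fintype.card_fin, Fintype.card_prod] at e2
    have e3 := h.sum_sub_one
    omega

/-- With z = x + y, the part of ker z^m killed by `evalNeg` is ker z^m ∩ im z ⊆ z(ker z^(m+1)), of
dimension dim ker z^(m+1) - r. Passing from ker z^m to ker z^(m+1) adds one dimension for each block
larger than m. -/
theorem IsJordanPartition.le_finrank_map_evalNeg {F : Type*} [Field F] {r s : ℕ}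
    {lam : Fin r → ℕ} (h : IsJordanPartition F r s lam) (hrs : r ≤ s) (m : ℕ) :
    r ≤ Module.finrank F ((LinearMap.ker (mulXAddY F r s ^ m).mulVecLin).map (evalNeg F r s)) +
      (Finset.univ.filter fun i => m < lam i).card := by
  have e1 := finrank_map_add_finrank_ker_inf (evalNeg F r s)
    (LinearMap.ker (mulXAddY F r s ^ m).mulVecLin)
  have e2 := finrank_map_add_finrank_ker_inf (mulXAddY F r s).mulVecLin
    (LinearMap.ker (mulXAddY F r s ^ (m + 1)).mulVecLin)
  have le1 : LinearMap.ker (mulXAddY F r s ^ m).mulVecLin ⊓ LinearMap.ker (evalNeg F r s) ≤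
      (LinearMap.ker (mulXAddY F r s ^ (m + 1)).mulVecLin).map (mulXAddY F r s).mulVecLin := by
    rw [h.ker_evalNeg hrs]
    rintro _ ⟨hv, v, rfl⟩
    refine ⟨v, ?_, rfl⟩
    have : (mulXAddY F r s ^ m).mulVec ((mulXAddY F r s).mulVec v) = 0 := hv
    rwa [Matrix.mulVec_mulVec, ← pow_succ] at this
  have e3 : LinearMap.ker (mulXAddY F r s ^ (m + 1)).mulVecLin ⊓
      LinearMap.ker (mulXAddY F r s).mulVecLin = LinearMap.ker (mulXAddY F r s ^ 1).mulVecLin := by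
    rw [pow_one, inf_eq_right]
    intro v hv
    have : (mulXAddY F r s).mulVec v = 0 := hv
    rw [LinearMap.mem_ker, Matrix.mulVecLin_apply, pow_succ, ← Matrix.mulVec_mulVec, this,
      Matrix.mulVec_zero]
  rw [e3] at e2
  have := Submodule.finrank_mono le1
  have := h.finrank_ker_pow m
  have := h.finrank_ker_pow (m + 1)
  have := h.finrank_ker_pow 1
  have := h.sum_sub_one
  have := card_lt_add_sum lam m
  omega

/-! ### Homogeneous generators and Jordan strings -/

/-- A subspace of codimension at most j cannot lie in the common kernel of the first j + 1
coordinates. -/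
theorem exists_apply_ne_zero_of_lt_finrank {F : Type*} [Field F] {r : ℕ}
    {Q : Submodule F (Fin r → F)} {j : Fin r} (hQ : r ≤ Module.finrank F Q + j) :
    ∃ c ≤ j, ∃ v ∈ Q, v c ≠ 0 := by
  by_contra! hc
  let f : (Fin r → F) →ₗ[F] (Fin ((j : ℕ) + 1) → F) :=
    LinearMap.funLeft F F (Fin.castLE j.2)
  have hf : Function.Surjective f :=
    LinearMap.funLeft_surjective_of_injective _ _ _ (Fin.castLE_injective j.2)
  have hle : Q ≤ LinearMap.ker f := by
    intro v hv
    rw [LinearMap.mem_ker]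
    ext i
    exact hc (Fin.castLE j.2 i) (Fin.le_def.2 (Nat.lt_succ_iff.1 i.2)) v hv
  have e := f.finrank_range_add_finrank_ker
  rw [LinearMap.range_eq_top.2 hf, finrank_top] at e
  simp only [Module.finrank_fintype_fun_eq_card, Fintype.card_fin] at e
  have := Submodule.finrank_mono hle
  omega

theorem IsJordanPartition.exists_homogeneous_generator {F : Type*} [Field F] {r s : ℕ}
    {lam : Fin r → ℕ} (h : IsJordanPartition F r s lam) (hrs : r ≤ s) (j : Fin r) :
    ∃ g : Fin r × Fin s → F, homogPart F r s j g = g ∧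
      (mulXAddY F r s ^ lam j).mulVec g = 0 ∧ evalNeg F r s g j ≠ 0 := by
  have hcard : (Finset.univ.filter fun i => lam j < lam i).card ≤ j := by
    rw [← Fin.card_Iio j]
    apply Finset.card_le_card
    intro i hi
    rw [Finset.mem_Iio]
    by_contra! hij
    exact (h.antitone hij).not_gt (Finset.mem_filter.1 hi).2
  obtain ⟨c, hcj, -, ⟨v, hv, rfl⟩, hvc⟩ := exists_apply_ne_zero_of_lt_finrank (j := j)
    ((h.le_finrank_map_evalNeg hrs (lam j)).trans (Nat.add_le_add_left hcard _))
  have hv : (mulXAddY F r s ^ lam j).mulVec v = 0 := hv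
  obtain ⟨k, hk⟩ := Nat.exists_eq_add_of_le (Fin.le_def.1 hcj)
  -- The degree c component of v is still killed by z^(λ_j); multiplying it by x^(j-c) moves it to
  -- degree j and keeps its nonzero image in F[x]/(x^r).
  refine ⟨(mulX F r s ^ k).mulVec (homogPart F r s c v), ?_, ?_, ?_⟩
  · rw [hk, homogPart_mulX_pow, homogPart_homogPart]
  · rw [Matrix.mulVec_mulVec, ← ((commute_mulX_mulXAddY F r s).pow_pow k (lam j)).eq,
      ← Matrix.mulVec_mulVec, ← homogPart_mulXAddY_pow, hv, map_zero, Matrix.mulVec_zero]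
  · rw [evalNeg_apply, hk, evalCoeff_dotProduct_mulX_pow (by omega),
      evalCoeff_dotProduct_homogPart, if_pos rfl]
    exact hvc

theorem evalNeg_eq_single {F : Type*} [Field F] {r s : ℕ} {j : Fin r} {g : Fin r × Fin s → F}
    (hg : homogPart F r s j g = g) :
    evalNeg F r s g = Pi.single j (evalNeg F r s g j) := by
  ext c
  by_cases hc : c = j
  · subst hc
    simp
  · rw [Pi.single_eq_of_ne hc, evalNeg_apply, ← hg, evalCoeff_dotProduct_homogPart,
      if_neg fun hh => hc (Fin.ext hh)]

theorem IsJordanPartition.linearIndependent_strings {F : Type*} [Field F] {r s : ℕ}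
    {lam : Fin r → ℕ} (h : IsJordanPartition F r s lam) (hrs : r ≤ s)
    {g : Fin r → Fin r × Fin s → F} (hg : ∀ j : Fin r, homogPart F r s j (g j) = g j)
    (hg0 : ∀ j, (mulXAddY F r s ^ lam j).mulVec (g j) = 0)
    (hg1 : ∀ j, evalNeg F r s (g j) j ≠ 0) :
    LinearIndependent F fun x : Σ j, Fin (lam j) =>
      (mulXAddY F r s ^ (x.2 : ℕ)).mulVec (g x.1) := by
  apply linearIndependent_of_top_le_span_of_card_eq_finrank
  · set Z := Submodule.span F (Set.range fun x : Σ j, Fin (lam j) =>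
      (mulXAddY F r s ^ (x.2 : ℕ)).mulVec (g x.1)) with hZ
    have hmem : ∀ j k, (mulXAddY F r s ^ k).mulVec (g j) ∈ Z := by
      intro j k
      by_cases hk : k < lam j
      · exact Submodule.subset_span ⟨⟨j, k, hk⟩, rfl⟩
      · obtain ⟨m, rfl⟩ := Nat.exists_eq_add_of_le' (not_lt.1 hk)
        rw [pow_add, ← Matrix.mulVec_mulVec, hg0, Matrix.mulVec_zero]
        exact Z.zero_mem
    have hstable : Z ≤ Z.comap (mulXAddY F r s).mulVecLin := by
      rw [hZ, Submodule.span_le, ← hZ]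
      rintro _ ⟨x, rfl⟩
      change (mulXAddY F r s).mulVec ((mulXAddY F r s ^ (x.2 : ℕ)).mulVec (g x.1)) ∈ Z
      rw [Matrix.mulVec_mulVec, ← pow_succ']
      exact hmem _ _
    -- The images of the generators are nonzero multiples of the monomials of F[x]/(x^r), so they
    -- span modulo the image of x + y.
    have hone : ∀ v, ∃ z ∈ Z, ∃ u, v = z + (mulXAddY F r s).mulVec u := by
      intro v
      let z := ∑ j, (evalNeg F r s v j / evalNeg F r s (g j) j) • g j
      have hz : z ∈ Z := Submodule.sum_mem _ fun j _ =>
        Z.smul_mem _ (by simpa using hmem j 0)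
      have hvz : v - z ∈ LinearMap.ker (evalNeg F r s) := by
        rw [LinearMap.mem_ker, map_sub, sub_eq_zero, map_sum]
        ext c
        rw [Finset.sum_apply, Finset.sum_eq_single c]
        · rw [map_smul, Pi.smul_apply, smul_eq_mul, div_mul_cancel₀ _ (hg1 c)]
        · intro j _ hj
          rw [map_smul, evalNeg_eq_single (hg j), Pi.smul_apply, Pi.single_eq_of_ne hj.symm,
            smul_zero]
        · simp
      rw [h.ker_evalNeg hrs] at hvz
      obtain ⟨u, hu⟩ := hvz
      exact ⟨z, hz, u, by rw [← Matrix.mulVecLin_apply, hu]; simp⟩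
    -- Iterating pushes the error into ever higher powers of the nilpotent x + y, so the strings
    -- span everything.
    have hpow : ∀ n v, ∃ z ∈ Z, ∃ u, v = z + (mulXAddY F r s ^ n).mulVec u := by
      intro n
      induction n with
      | zero => exact fun v => ⟨0, Z.zero_mem, v, by simp⟩
      | succ n ih =>
        intro v
        obtain ⟨z, hz, u, rfl⟩ := hone v
        obtain ⟨z', hz', u', rfl⟩ := ih u
        refine ⟨z + (mulXAddY F r s).mulVec z', Z.add_mem hz (hstable hz'), u', ?_⟩
        rw [Matrix.mulVec_add, Matrix.mulVec_mulVec, ← pow_succ', add_assoc]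
    have hnil : mulXAddY F r s ^ (r * s) = 0 := by
      rw [← Matrix.toLin'.map_eq_zero_iff, Matrix.toLin'_apply', ← LinearMap.range_eq_bot,
        ← Submodule.finrank_eq_zero (R := F)]
      refine (h.rank_mulXAddY_pow _).trans ?_
      refine Finset.sum_eq_zero fun i _ => Nat.sub_eq_zero_of_le ?_
      rw [← h.sum_eq]
      exact Finset.single_le_sum (fun _ _ => Nat.zero_le _) (Finset.mem_univ i)
    intro v _
    obtain ⟨z, hz, u, rfl⟩ := hpow (r * s) v
    rw [hnil]
    simpa using hz
  · simp [h.sum_eq]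

/-- The deviation vector `ε` makes `j ↦ ε j + j` a permutation of `{0, …, r - 1}`. -/
theorem IsJordanPartition.injective_and_mem_Ico {F : Type*} [Field F] {r s : ℕ}
    {lam : Fin r → ℕ} (h : IsJordanPartition F r s lam) (hrs : r ≤ s) :
    Function.Injective (fun j : Fin r => (lam j : ℤ) - s + ((j : ℕ) : ℤ)) ∧
      ∀ j : Fin r, (lam j : ℤ) - s + ((j : ℕ) : ℤ) ∈ Set.Ico (0 : ℤ) r := by
  choose g hg hg0 hg1 using h.exists_homogeneous_generator hrs
  have hli := h.linearIndependent_strings hrs hg hg0 hg1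
  have hpos := h.pos
  -- The index of the last vector of each string, which lies in the kernel of x + y in degree j +
  -- λ_j - 1.
  let e : Fin r → Σ j, Fin (lam j) := fun j => ⟨j, lam j - 1, by have := hpos j; omega⟩
  have he : Function.Injective e := fun i j hij => congrArg Sigma.fst hij
  have hliw := hli.comp e he
  set w : Fin r → Fin r × Fin s → F :=
    fun j => (mulXAddY F r s ^ (lam j - 1)).mulVec (g j) with hw
  have hliw : LinearIndependent F w := hliw
  have hw0 : ∀ j, (mulXAddY F r s).mulVec (w j) = 0 := by
    intro j
    rw [hw, Matrix.mulVec_mulVec, ← pow_succ', Nat.sub_add_cancel (hpos j), hg0]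
  have hwd : ∀ j : Fin r, homogPart F r s (j + (lam j - 1)) (w j) = w j := by
    intro j
    rw [hw, homogPart_mulXAddY_pow, hg]
  constructor
  · intro i j hij
    by_contra hne
    have hd : (j : ℕ) + (lam j - 1) = i + (lam i - 1) := by
      have := hpos i
      have := hpos j
      simp only at hij
      omega
    refine not_linearIndependent_of_homogPart_eq (hw0 i) (hw0 j) (hwd i) (hd ▸ hwd j) ?_
    have hinj : Function.Injective ![i, j] := by
      intro a b hab
      fin_cases a <;> fin_cases b <;> simp_all
    convert hliw.comp ![i, j] hinj using 1
    ext a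
    fin_cases a <;> rfl
  · intro j
    -- A monomial x^i y^(s-1) of degree j + λ_j - 1 gives λ_j - s + j = i with 0 ≤ i < r.
    obtain ⟨x, hx1, hx2, -⟩ :=
      exists_apply_ne_zero_of_homogPart_eq (hw0 j) (hwd j) (hliw.ne_zero j)
    have := hpos j
    have := x.1.2
    rw [Set.mem_Ico]
    omega

end JordanTensor

theorem mainTheorem5 (r : ℕ) (hr : 1 ≤ r) :
    {ε : Fin r → ℤ | ∃ (s p : ℕ) (hs : r ≤ s), p.Prime ∧
        ∃ (F : Type u) (_ : Field F) (_ : CharP F p),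
          ε = JordanTensor.deviationVector F hs}.Finite ∧
    {ε : Fin r → ℤ | ∃ (s p : ℕ) (hs : r ≤ s), p.Prime ∧
        ∃ (F : Type u) (_ : Field F) (_ : CharP F p),
          ε = JordanTensor.deviationVector F hs}.ncard ≤ 2 ^ (r - 1) := by
  obtain ⟨n, rfl⟩ := Nat.exists_eq_add_of_le' hr
  apply JordanTensor.finite_and_ncard_le_of_antitone
  rintro _ ⟨s, p, hs, -, F, _, -, rfl⟩
  have h := (JordanTensor.isJordanPartition_iff F hs _).2 rfl
  obtain ⟨h1, h2⟩ := h.injective_and_mem_Ico hs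
  exact ⟨fun i j hij => Int.sub_le_sub_right (Int.ofNat_le.2 (h.antitone hij)) _, h1, h2⟩
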